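/- Let $p$ be an odd prime, let $K/\mathbb{Q}$ be a Galois extension of degree $p$ with Galois group $G=\langle\sigma\rangle$, let $Cl_K$ be its ideal class group, $Cl_K^G$ the subgroup of classes fixed by $G$, and let $r$ be the number of rational primes that ramify in $K$. Then $r\ge 1$ and $$\left|Cl_K^G\right|=p^{\,r-1}.$$ Every element of $Cl_K^G$ is killed by $p$, so $Cl_K^G=Cl_K[p]^G$. The group $Cl_K^G$ is generated by the classes of the ramified prime ideals $P_1,\dots,P_r$ of $K$. Let $h$ be the endomorphism $u\mapsto u/\sigma(u)$ of $\mathcal{O}_K^\times/\{\pm1\}$. Its image has index $p$. Every class of $\mathcal{O}_K^\times/\{\pm1\}$ that is not in the image of $h$ is represented by a unit $u\in\mathcal{O}_K^\times$ for which there are a nonzero $x\in\mathcal{O}_K$ and exponents $0\le a_1,\dots,a_r\le p-1$, not all zero, with $$\sigma(x)=u\,x,\qquad (x)=P_1^{a_1}\cdots P_r^{a_r},$$ and this relation is the only one modulo $p$: for integers $e_1,\dots,e_r$, the class of $P_1^{e_1}\cdots P_r^{e_r}$ is trivial if and only if there is an integer $k$ with $e_i\equiv k a_i \pmod p$ for all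 $i$. -/

import Mathlib

open NumberField IsDedekindDomain

noncomputable section

namespace CyclicClassGroup

variable (K : Type*) [Field K] [NumberField K]

/-- The rational primes that ramify in `K`. -/
def ramifiedRationalPrimes : Set ℕ :=
  {q : ℕ | q.Prime ∧ ¬ Algebra.IsUnramifiedIn (𝓞 K) (Ideal.span {(q : ℤ)})}

/-- The nonzero prime ideals of `𝓞 K` that are ramified over `ℤ`. -/
def ramifiedPrimeIdeals : Set (HeightOneSpectrum (𝓞 K)) :=
  {P | ¬ Algebra.IsUnramifiedAt ℤ P.asIdeal}

/-- The action of a field automorphism on the ideal class group. -/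
def galoisClassAction (g : Gal(K/ℚ)) : ClassGroup (𝓞 K) ≃* ClassGroup (𝓞 K) :=
  ClassGroup.mulEquiv (MulSemiringAction.toRingEquiv Gal(K/ℚ) (𝓞 K) g)

/-- The group of ideal classes fixed by every field automorphism of `K`. -/
def invariantClasses : Subgroup (ClassGroup (𝓞 K)) :=
  ⨅ g : Gal(K/ℚ), (galoisClassAction K g).toMonoidHom.eqLocus (MonoidHom.id _)

variable {K}

/-- The ideal class of a nonzero prime ideal. -/
def primeClass (P : HeightOneSpectrum (𝓞 K)) : ClassGroup (𝓞 K) :=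
  ClassGroup.mk0 ⟨P.asIdeal, mem_nonZeroDivisors_iff_ne_zero.mpr P.ne_bot⟩

/-- The class of the product of the ramified primes `P` to the powers `e P`. -/
def ramifiedProductClass (e : ramifiedPrimeIdeals K →₀ ℤ) : ClassGroup (𝓞 K) :=
  e.prod fun P n => primeClass P.1 ^ n

/-- The homomorphism `u ↦ u / σ u` on the units of `𝓞 K`. -/
def unitOneSub (σ : Gal(K/ℚ)) : (𝓞 K)ˣ →* (𝓞 K)ˣ :=
  MonoidHom.id (𝓞 K)ˣ /
    Units.map (MulSemiringAction.toRingHom Gal(K/ℚ) (𝓞 K) σ : 𝓞 K →* 𝓞 K)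

variable (K) in
/-- The group of units of `𝓞 K` modulo `{1, -1}`. -/
abbrev UnitsModSign : Type _ := (𝓞 K)ˣ ⧸ Subgroup.zpowers (-1 : (𝓞 K)ˣ)

theorem zpowers_neg_one_le_comap (σ : Gal(K/ℚ)) :
    Subgroup.zpowers (-1 : (𝓞 K)ˣ) ≤
      (Subgroup.zpowers (-1 : (𝓞 K)ˣ)).comap (unitOneSub σ) := by
  rw [Subgroup.zpowers_le, Subgroup.mem_comap]
  have h : unitOneSub σ (-1 : (𝓞 K)ˣ) = 1 := by
    rw [unitOneSub, MonoidHom.div_apply, div_eq_one]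
    ext
    simp
  rw [h]
  exact one_mem _

/-- The endomorphism induced by `u ↦ u / σ u` on the units modulo `{1, -1}`. -/
def unitsModSignOneSub (σ : Gal(K/ℚ)) : UnitsModSign K →* UnitsModSign K :=
  QuotientGroup.map _ _ (unitOneSub σ) (zpowers_neg_one_le_comap σ)

end CyclicClassGroup

end

/-! ### The index of `1 - f` on a lattice killed by `1 + f + ⋯ + f^(p-1)` -/

noncomputable section

/-! Three inputs combine: a determinant on the unit lattice, Hilbert 90, and the factorization of
Galois-invariant ideals.

Units. Since `K` is Galois of odd degree, it is totally real, so the units modulo sign form a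
lattice of rank `p - 1`. The norm `1 + σ + ⋯ + σ^(p-1)` kills it, so `σ` has characteristic
polynomial Φ_p there, and `1 - σ` has determinant Φ_p(1) = p. Its image therefore has index `p`
(`index_range_unitsModSignOneSub`).

Generators. If the class of `I` is fixed, then `(x) σI = (y) I` with `x`, `y` of equal norm after a
change of sign. Hilbert 90 writes `y / x` as `z / σz`, and `(z) I` is then an invariant ideal
(`exists_invariant_ideal`). Such an ideal is a rational integer times a product of ramified primes,
each of which has its `p`-th power generated by a rational prime. So the ramified classes generate,
and `p` kills them.

Relations. For a principal ideal `(y)` that is a product of ramified primes, `σy = v y` with `v` of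
norm one, and changing `y` by a unit changes `v` by some `w / σw`. Norm-one units modulo these are
generated by a single `u`. Hilbert 90 turns `u` into one relation `(x)`, nontrivial because `u` is
not of the form `w / σw`; every other relation is a power of it up to rational factors, which have
exponents divisible by `p` at ramified primes. Hence the classes form the quotient of `(ℤ/p)^r` by a
line. -/

open Polynomial in
theorem LinearMap.charpoly_eq_cyclotomic {V : Type*} [AddCommGroup V] [Module ℚ V]
    [FiniteDimensional ℚ V] {p : ℕ} (hp : p.Prime) (hV : Module.finrank ℚ V = p - 1)
    (f : V →ₗ[ℚ] V) (hf : ∑ i ∈ Finset.range p, f ^ i = 0) :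
    f.charpoly = cyclotomic p ℚ := by
  have := Fact.mk hp
  have hV' : 0 < Module.finrank ℚ V := by have := hp.two_le; omega
  have : Nontrivial V := Module.nontrivial_of_finrank_pos hV'
  have h0 : aeval f (cyclotomic p ℚ) = 0 := by
    rw [cyclotomic_prime]; simpa using hf
  have hirr : Irreducible (cyclotomic p ℚ) := cyclotomic.irreducible_rat hp.pos
  have hmin : cyclotomic p ℚ = minpoly ℚ f :=
    minpoly.eq_of_irreducible_of_monic hirr h0 (cyclotomic.monic p ℚ)
  have hdvd := f.minpoly_dvd_charpoly
  rw [← hmin] at hdvd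
  -- Both polynomials are monic of degree `p - 1`, so divisibility forces equality.
  refine eq_of_monic_of_dvd_of_natDegree_le (cyclotomic.monic p ℚ) f.charpoly_monic hdvd ?_
  rw [LinearMap.charpoly_natDegree, hV, natDegree_cyclotomic, Nat.totient_prime hp]

/-- The determinant is the characteristic polynomial at 1, and Φ_p(1) = p. Extending scalars to ℚ
makes irreducibility of Φ_p available without changing the determinant. -/
theorem LinearMap.det_one_sub_eq_prime {M : Type*} [AddCommGroup M] [Module.Free ℤ M]
    [Module.Finite ℤ M] {p : ℕ} (hp : p.Prime) (hM : Module.finrank ℤ M = p - 1)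
    (f : M →ₗ[ℤ] M) (hf : ∑ i ∈ Finset.range p, f ^ i = 0) :
    LinearMap.det (1 - f : Module.End ℤ M) = (p : ℤ) := by
  have := Fact.mk hp
  have h1 : (f.baseChange ℚ).charpoly = Polynomial.cyclotomic p ℚ := by
    apply LinearMap.charpoly_eq_cyclotomic hp
    · rw [Module.finrank_baseChange, hM]
    · simp_rw [← LinearMap.baseChange_pow]
      have := congrArg (Module.End.baseChangeHom ℤ ℚ M) hf
      rw [map_sum, map_zero] at this
      exact this
  have h2 := LinearMap.eval_charpoly (f.baseChange ℚ) 1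
  rw [h1, Polynomial.eval_one_cyclotomic_prime, map_one] at h2
  have h3 : (1 : Module.End ℚ (TensorProduct ℤ ℚ M)) - f.baseChange ℚ = (1 - f).baseChange ℚ := by

    rw [LinearMap.baseChange_sub]; congr 1; ext; simp
  rw [h3, LinearMap.det_baseChange] at h2
  have h4 : ((p : ℤ) : ℚ) = (LinearMap.det (1 - f) : ℤ) := by simpa using h2
  exact (Int.cast_injective h4).symm

theorem LinearMap.card_quotient_range_one_sub {M : Type*} [AddCommGroup M] [Module.Free ℤ M]
    [Module.Finite ℤ M] {p : ℕ} (hp : p.Prime) (hM : Module.finrank ℤ M = p - 1)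
    (f : M →ₗ[ℤ] M) (hf : ∑ i ∈ Finset.range p, f ^ i = 0) :
    Nat.card (M ⧸ LinearMap.range (1 - f : Module.End ℤ M)) = p := by
  have hdet := LinearMap.det_one_sub_eq_prime hp hM f hf
  have hinj : Function.Injective (1 - f : Module.End ℤ M) := by
    rw [← LinearMap.ker_eq_bot]
    by_contra h
    have h5 := (LinearMap.det_eq_zero_iff_ker_ne_bot (f := (1 - f : Module.End ℤ M))).2 h
    rw [hdet] at h5
    exact hp.ne_zero (by exact_mod_cast h5)
  rw [← Submodule.natAbs_det_equiv _ (LinearEquiv.ofInjective (1 - f : Module.End ℤ M) hinj)]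
  have : (LinearMap.range (1 - f : Module.End ℤ M)).subtype ∘ₗ
      AddMonoidHom.toIntLinearMap ((LinearEquiv.ofInjective (1 - f : Module.End ℤ M) hinj : M ≃ₗ[ℤ] _) :
        M →+ LinearMap.range (1 - f : Module.End ℤ M)) = 1 - f := by
    ext x; rfl
  rw [this, hdet]; simp

theorem MonoidHom.index_range_of_sum_pow_eq_zero {U : Type*} [CommGroup U]
    [Module.Free ℤ (Additive U)] [Module.Finite ℤ (Additive U)] {p : ℕ} (hp : p.Prime)
    (hU : Module.finrank ℤ (Additive U) = p - 1) (s h : U →* U) (hsh : ∀ u, h u = u / s u)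
    (hs : ∀ u, ∏ i ∈ Finset.range p, (s^[i]) u = 1) : h.range.index = p := by
  let f : Additive U →ₗ[ℤ] Additive U := s.toAdditive.toIntLinearMap
  have hpow : ∀ (i : ℕ) (u : U), (f ^ i) (Additive.ofMul u) = Additive.ofMul ((s^[i]) u) := by
    intro i
    induction i with
    | zero => intro u; rfl
    | succ i ih =>
      intro u
      rw [pow_succ, Function.iterate_succ_apply]
      exact ih (s u)
  have hf : ∑ i ∈ Finset.range p, f ^ i = 0 := by
    ext u
    obtain ⟨u, rfl⟩ := Additive.ofMul.surjective u
    rw [LinearMap.sum_apply]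
    simp_rw [hpow]
    rw [← ofMul_prod, hs]; rfl
  rw [← LinearMap.card_quotient_range_one_sub hp hU f hf]
  have hr : (LinearMap.range (1 - f : Module.End ℤ (Additive U))).toAddSubgroup =
      h.range.toAddSubgroup := by
    ext u
    obtain ⟨u, rfl⟩ := Additive.ofMul.surjective u
    constructor
    · rintro ⟨v, hv⟩
      exact ⟨v.toMul, (hsh _).trans hv⟩
    · rintro ⟨v, hv⟩
      exact ⟨Additive.ofMul v, (hsh v).symm.trans hv⟩
  have h2 : (LinearMap.range (1 - f : Module.End ℤ (Additive U))).toAddSubgroup.index =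
    h.range.index := by rw [hr]; exact Subgroup.index_toAddSubgroup
  rw [← h2]; rfl

/-! ### Hilbert 90 and its integral form -/

/-- Hilbert 90: a nonzero value of the resolvent `∑ c i * (s ^ i) t`, with `c i` the partial norms
of `x`, serves as `y`. Such a `t` exists by independence of characters. -/
theorem exists_mul_apply_eq_of_prod_iterate_eq_one {F L : Type*} [Field F] [Field L] [Algebra F L]
    {p : ℕ} (hp : 0 < p) (s : Gal(L/F)) (hs : orderOf s = p) (x : L)
    (hx : ∏ i ∈ Finset.range p, (s ^ i) x = 1) : ∃ y : L, y ≠ 0 ∧ x * s y = y := by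
  let c : ℕ → L := fun i => ∏ j ∈ Finset.range i, (s ^ j) x
  have hc : ∀ i, x * s (c i) = c (i + 1) := by
    intro i
    simp only [c, map_prod]
    rw [Finset.prod_range_succ', mul_comm]
    simp [pow_succ']
  have hli : LinearIndependent L (fun i : Fin p => ((s ^ (i : ℕ) : Gal(L/F)) : L → L)) := by
    have := linearIndependent_monoidHom L L
    refine this.comp (fun i : Fin p => ((s ^ (i : ℕ) : Gal(L/F)) : L →* L)) ?_
    intro i j hij
    have h : s ^ (i : ℕ) = s ^ (j : ℕ) := by
      ext z; exact DFunLike.congr_fun hij z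
    have := pow_injOn_Iio_orderOf (x := s) (by simp [hs]) (by simp [hs]) h
    exact Fin.ext this
  have hne : ∃ t : L, ∑ i ∈ Finset.range p, c i * (s ^ i) t ≠ 0 := by
    by_contra! H
    -- The coefficient at index 0 is the empty product 1, so the combination is not trivial.
    have := Fintype.linearIndependent_iff.1 hli (fun i => c i) (by
      ext t
      have := H t
      rw [← Fin.sum_univ_eq_sum_range (fun i => c i * (s ^ i) t)] at this
      simpa using this) ⟨0, hp⟩
    simp [c] at this
  obtain ⟨t, ht⟩ := hne
  refine ⟨_, ht, ?_⟩
  rw [map_sum, Finset.mul_sum]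
  have h1 : ∀ i, x * s (c i * (s ^ i) t) = c (i + 1) * (s ^ (i + 1)) t := by
    intro i
    rw [map_mul, ← mul_assoc, hc, pow_succ']; rfl
  simp_rw [h1]
  -- Multiplying by `x` after applying `s` shifts the index; the term at `p` equals the term at 0
  -- because `x` has norm 1.
  have h2 := Finset.sum_range_succ (fun i => c i * (s ^ i) t) p
  rw [Finset.sum_range_succ'] at h2
  have h3 : c p * (s ^ p) t = c 0 * (s ^ 0) t := by
    rw [← hs, pow_orderOf_eq_one, hs]
    simp only [c, hx]; simp
  rw [h3] at h2
  exact add_right_cancel h2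

namespace CyclicClassGroup

variable {K : Type*} [Field K] [NumberField K]

theorem coe_smul_ringOfIntegers (g : Gal(K/ℚ)) (x : 𝓞 K) : ((g • x : 𝓞 K) : K) = g x := rfl

variable {p : ℕ} {σ : Gal(K/ℚ)}

section Cyclic

variable [IsGalois ℚ K] (hdeg : Module.finrank ℚ K = p) (hσ : ∀ g : Gal(K/ℚ), g ∈ Subgroup.zpowers σ)

include hdeg hσ

theorem orderOf_eq_finrank : orderOf σ = p := by
  rw [orderOf_eq_card_of_forall_mem_zpowers hσ, IsGalois.card_aut_eq_finrank, hdeg]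

theorem norm_eq_prod_pow (x : K) :
    algebraMap ℚ K (Algebra.norm ℚ x) = ∏ i ∈ Finset.range p, (σ ^ i) x := by
  rw [Algebra.norm_eq_prod_automorphisms, ← orderOf_eq_finrank hdeg hσ]
  classical
  rw [← IsCyclic.image_range_orderOf hσ, Finset.prod_image]
  intro i hi j hj h
  exact pow_injOn_Iio_orderOf (by simpa using hi) (by simpa using hj) h

/-- Hilbert 90 for `y / x`; the solution is made integral by a rational integer, which `σ` fixes. -/
theorem exists_mul_smul_eq_mul_of_norm_eq {x y : 𝓞 K} (hx : x ≠ 0)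
    (h : Algebra.norm ℚ (x : K) = Algebra.norm ℚ (y : K)) :
    ∃ z : 𝓞 K, z ≠ 0 ∧ y * σ • z = x * z := by
  have hx' : (x : K) ≠ 0 := by simpa using hx
  have hn : Algebra.norm ℚ ((y : K) / x) = 1 := by
    have hm : (x : K) * (y / x) = y := by field_simp
    have := congrArg (Algebra.norm ℚ) hm
    rw [map_mul, ← h] at this
    exact mul_left_cancel₀ (Algebra.norm_ne_zero_iff.2 hx') (this.trans (mul_one _).symm)
  obtain ⟨w, hw0, hw⟩ := exists_mul_apply_eq_of_prod_iterate_eq_one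
    (hdeg ▸ Module.finrank_pos) σ (orderOf_eq_finrank hdeg hσ) ((y : K) / x)
    (by rw [← norm_eq_prod_pow hdeg hσ, hn, map_one])
  obtain ⟨n, hn0, hint⟩ := IsAlgebraic.exists_integral_multiple
    ((IsFractionRing.isAlgebraic_iff ℤ ℚ K).2 (Algebra.IsAlgebraic.isAlgebraic w))
  obtain ⟨a, ha⟩ : ∃ a : 𝓞 K, (a : K) = n * w := ⟨⟨n • w, hint⟩, by simp⟩
  have hn0' : (n : K) ≠ 0 := by exact_mod_cast hn0
  refine ⟨a, ?_, ?_⟩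
  · rintro rfl
    simp [hn0', hw0] at ha
  · apply RingOfIntegers.ext
    simp only [map_mul, coe_smul_ringOfIntegers, ha, map_intCast]
    rw [div_mul_eq_mul_div, div_eq_iff hx'] at hw
    linear_combination (n : K) * hw

omit hdeg in
theorem exists_intCast_mul_eq_of_smul_mul_eq {x y : 𝓞 K} (hx : x ≠ 0) (hy : y ≠ 0)
    (h : (σ • x) * y = x * σ • y) : ∃ m n : ℤ, m ≠ 0 ∧ n ≠ 0 ∧ m * x = n * y := by
  have hx' : (x : K) ≠ 0 := by simpa using hx
  have hy' : (y : K) ≠ 0 := by simpa using hy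
  have hfix : σ ((x : K) / y) = x / y := by
    have h' := congrArg (algebraMap (𝓞 K) K) h
    simp only [map_mul, coe_smul_ringOfIntegers] at h'
    rw [map_div₀, div_eq_div_iff _ hy', h']
    simpa using hy'
  have hfix' : ∀ g : Gal(K/ℚ), g ((x : K) / y) = x / y := by
    intro g
    have h1 : σ ∈ MulAction.stabilizer Gal(K/ℚ) ((x : K) / y) := hfix
    exact (Subgroup.zpowers_le.2 h1) (hσ g)
  obtain ⟨q, hq⟩ := (IsGalois.mem_range_algebraMap_iff_fixed (F := ℚ) _).2 hfix'
  refine ⟨q.den, q.num, by simp, ?_, ?_⟩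
  · rw [Rat.num_ne_zero]
    rintro rfl
    rw [map_zero] at hq
    exact div_ne_zero hx' hy' hq.symm
  · apply RingOfIntegers.ext
    have h2 : (q.den : K) ≠ 0 := by simp
    simp only [map_mul, map_intCast, Int.cast_natCast]
    rw [eq_comm, div_eq_iff hy'] at hq
    have h3 : (q.den : K) * (q : K) = (q.num : K) := by
      exact_mod_cast congrArg (Rat.cast : ℚ → K) (Rat.den_mul_eq_num q)
    rw [eq_ratCast] at hq
    rw [map_natCast, ← h3]
    linear_combination (q.den : K) * hq

end Cyclic
end CyclicClassGroup

/-! ### Units modulo sign -/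

theorem Subgroup.index_range_quotient_of_prod_iterate_mem {A : Type*} [CommGroup A]
    {H T : Subgroup A} (hHT : H = T) (hfree : Module.Free ℤ (Additive (A ⧸ T)))
    (hfin : Module.Finite ℤ (Additive (A ⧸ T))) {p : ℕ} (hp : p.Prime)
    (hrank : Module.finrank ℤ (Additive (A ⧸ T)) = p - 1) (t : A →* A) (ht : H ≤ H.comap t)
    (h : A ⧸ H →* A ⧸ H) (hh : ∀ a : A, h a = (a / t a : A))
    (hs : ∀ a, ∏ i ∈ Finset.range p, t^[i] a ∈ H) : h.range.index = p := by
  subst hHT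
  let s : A ⧸ H →* A ⧸ H := QuotientGroup.map _ _ t ht
  refine MonoidHom.index_range_of_sum_pow_eq_zero hp hrank s h ?_ ?_
  · intro u
    obtain ⟨u, rfl⟩ := QuotientGroup.mk_surjective u
    rw [hh]; rfl
  · intro u
    obtain ⟨u, rfl⟩ := QuotientGroup.mk_surjective u
    have hit : ∀ i : ℕ, s^[i] (u : A ⧸ H) = ((t^[i] u : A) : A ⧸ H) := by
      intro i
      induction i with
      | zero => rfl
      | succ i ih => rw [Function.iterate_succ_apply', ih, Function.iterate_succ_apply']; rfl
    simp_rw [hit]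
    have : ∏ i ∈ Finset.range p, ((t^[i] u : A) : A ⧸ H) =
        ((∏ i ∈ Finset.range p, t^[i] u : A) : A ⧸ H) :=
      (map_prod (QuotientGroup.mk' H) _ _).symm
    rw [this, QuotientGroup.eq_one_iff]
    exact hs u

theorem Subgroup.exists_inv_zpow_mul_mem_of_prime_index {A : Type*} [CommGroup A] {N : Subgroup A}
    {p : ℕ} (hp : p.Prime) (hN : N.index = p) {u : A} (hu : u ∉ N) (v : A) :
    ∃ k : ℤ, (u ^ k)⁻¹ * v ∈ N := by
  have := Fact.mk hp
  have hgen : Subgroup.zpowers (u : A ⧸ N) = ⊤ :=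
    zpowers_eq_top_of_prime_card (p := p) hN (by rwa [Ne, QuotientGroup.eq_one_iff])
  obtain ⟨k, hk⟩ : (v : A ⧸ N) ∈ Subgroup.zpowers (u : A ⧸ N) := by rw [hgen]; trivial
  exact ⟨k, QuotientGroup.eq.1 hk⟩

namespace CyclicClassGroup

variable {K : Type*} [Field K] [NumberField K] {p : ℕ} {σ : Gal(K/ℚ)}

theorem zpowers_neg_one_eq_torsion (h : Odd (Module.finrank ℚ K)) :
    Subgroup.zpowers (-1 : (𝓞 K)ˣ) = Units.torsion K := by
  apply le_antisymm
  · rw [Subgroup.zpowers_le]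
    exact neg_one_mem_torsion
  · intro u hu
    rcases Units.torsion_eq_one_or_neg_one_of_odd_finrank h ⟨u, hu⟩ with h | h <;>
      simp only at h <;> rw [h]
    · exact one_mem _
    · exact Subgroup.mem_zpowers _

/-- An odd-degree Galois extension of ℚ is unramified at infinity, so it has as many infinite places
as its degree. -/
theorem unit_rank_of_odd [IsGalois ℚ K] (h : Odd (Module.finrank ℚ K)) :
    Units.rank K = Module.finrank ℚ K - 1 := by
  have := IsUnramifiedAtInfinitePlaces_of_odd_finrank (k := ℚ) (K := K) h
  rw [Units.rank, IsUnramifiedAtInfinitePlaces.card_infinitePlace ℚ K, Fintype.card_unique, one_mul]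

theorem coe_eq_one_or_neg_one_of_norm {u v : (𝓞 K)ˣ}
    (h : ((v : 𝓞 K) : K) = algebraMap ℚ K (Algebra.norm ℚ ((u : 𝓞 K) : K))) :
    v ∈ Subgroup.zpowers (-1 : (𝓞 K)ˣ) := by
  have hn := Units.norm K u
  rcases abs_eq (zero_le_one) |>.1 hn with hn | hn <;> rw [hn] at h
  · have : v = 1 := by ext; simpa using h
    rw [this]; exact one_mem _
  · have : v = -1 := by ext; simpa using h
    rw [this]; exact Subgroup.mem_zpowers _

theorem unitOneSub_coe_mul (u : (𝓞 K)ˣ) :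
    (unitOneSub σ u : 𝓞 K) * σ • (u : 𝓞 K) = u := by
  have : unitOneSub σ u * Units.map (MulSemiringAction.toRingHom Gal(K/ℚ) (𝓞 K) σ : 𝓞 K →* 𝓞 K) u
    = u := by simp [unitOneSub, MonoidHom.div_apply]
  exact congrArg Units.val this

variable [IsGalois ℚ K] (hdeg : Module.finrank ℚ K = p) (hσ : ∀ g : Gal(K/ℚ), g ∈ Subgroup.zpowers σ)

include hdeg hσ

theorem index_range_unitsModSignOneSub (hp : p.Prime) (hp2 : p ≠ 2) :
    (unitsModSignOneSub σ).range.index = p := by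
  have hodd : Odd (Module.finrank ℚ K) := hdeg ▸ hp.odd_of_ne_two hp2
  have h3 := Units.finrank_modTorsion K
  rw [unit_rank_of_odd hodd, hdeg] at h3
  let t : (𝓞 K)ˣ →* (𝓞 K)ˣ :=
    Units.map (MulSemiringAction.toRingHom Gal(K/ℚ) (𝓞 K) σ : 𝓞 K →* 𝓞 K)
  refine Subgroup.index_range_quotient_of_prod_iterate_mem (A := (𝓞 K)ˣ)
    (zpowers_neg_one_eq_torsion hodd) inferInstance inferInstance hp h3 t ?_
    (unitsModSignOneSub σ) (fun a => rfl) ?_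
  · rw [Subgroup.zpowers_le, Subgroup.mem_comap]
    have : t (-1) = -1 := by ext; simp [t]
    rw [this]; exact Subgroup.mem_zpowers _
  · intro u
    have hit : ∀ i : ℕ, ((t^[i] u : 𝓞 K) : K) = (σ ^ i) ((u : 𝓞 K) : K) := by
      intro i
      induction i with
      | zero => rfl
      | succ i ih => rw [Function.iterate_succ_apply', pow_succ', AlgEquiv.mul_apply, ← ih]; rfl
    apply coe_eq_one_or_neg_one_of_norm (u := u)
    rw [norm_eq_prod_pow hdeg hσ, Units.coe_prod]
    refine (map_prod (algebraMap (𝓞 K) K) _ _).trans ?_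
    exact Finset.prod_congr rfl fun i _ => hit i

omit hσ [IsGalois ℚ K] in
theorem norm_neg (hp : p.Prime) (hp2 : p ≠ 2) (x : K) :
    Algebra.norm ℚ (-x) = - Algebra.norm ℚ x := by
  have hodd : Odd (Module.finrank ℚ K) := hdeg ▸ hp.odd_of_ne_two hp2
  rw [← neg_one_mul, map_mul]
  have := Algebra.norm_algebraMap (S := K) (-1 : ℚ)
  rw [map_neg, map_one, hodd.neg_one_pow] at this
  rw [this, neg_one_mul]

omit hσ [IsGalois ℚ K] in
-- In odd degree `-1` has norm `-1`, so a sign change corrects the norm.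
theorem exists_norm_one_rep (hp : p.Prime) (hp2 : p ≠ 2) (c : UnitsModSign K) :
    ∃ u : (𝓞 K)ˣ, (u : UnitsModSign K) = c ∧ Algebra.norm ℚ ((u : 𝓞 K) : K) = 1 := by
  obtain ⟨u, rfl⟩ := QuotientGroup.mk_surjective c
  rcases abs_eq (zero_le_one) |>.1 (Units.norm K u) with hn | hn
  · exact ⟨u, rfl, hn⟩
  · refine ⟨-u, ?_, ?_⟩
    · rw [QuotientGroup.eq]
      simp
    · have : ((-u : 𝓞 K) : K) = -((u : 𝓞 K) : K) := map_neg _ _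
      rw [Units.val_neg, this, norm_neg hdeg hp hp2, hn, neg_neg]

omit hdeg hσ [IsGalois ℚ K] in
theorem norm_smul (x : 𝓞 K) : Algebra.norm ℚ ((σ • x : 𝓞 K) : K) = Algebra.norm ℚ (x : K) :=
  Algebra.norm_eq_of_algEquiv σ (x : K)

/-- A norm-one unit whose class is not of the form `w / σ w` generates all norm-one units
modulo those of this form. -/
theorem exists_eq_zpow_mul (hp : p.Prime) (hp2 : p ≠ 2) {u v : (𝓞 K)ˣ}
    (hu : (u : UnitsModSign K) ∉ (unitsModSignOneSub σ).range)
    (hun : Algebra.norm ℚ ((u : 𝓞 K) : K) = 1) (hvn : Algebra.norm ℚ ((v : 𝓞 K) : K) = 1) :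
    ∃ (k : ℤ) (w : (𝓞 K)ˣ), v = u ^ k * unitOneSub σ w := by
  have hidx := index_range_unitsModSignOneSub hdeg hσ hp hp2
  obtain ⟨k, hk⟩ := Subgroup.exists_inv_zpow_mul_mem_of_prime_index (A := (𝓞 K)ˣ)
    (N := (unitsModSignOneSub σ).range.comap (QuotientGroup.mk' _)) hp
    ((Subgroup.index_comap_of_surjective _ (QuotientGroup.mk'_surjective _)).trans hidx) hu v
  obtain ⟨w, hw⟩ := hk
  obtain ⟨w, rfl⟩ := QuotientGroup.mk_surjective w
  have hw' : ((unitOneSub σ w : (𝓞 K)ˣ) : UnitsModSign K) =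
    (((u ^ k)⁻¹ * v : (𝓞 K)ˣ) : UnitsModSign K) := hw
  rw [QuotientGroup.eq] at hw'
  refine ⟨k, w, ?_⟩
  let N : (𝓞 K)ˣ →* ℚˣ := Units.map ((Algebra.norm ℚ).comp (algebraMap (𝓞 K) K : 𝓞 K →* K))
  have hNu : N u = 1 := Units.ext hun
  have hNv : N v = 1 := Units.ext hvn
  have hNw : N (unitOneSub σ w) = 1 := by
    rw [unitOneSub, MonoidHom.div_apply, map_div, div_eq_one]
    exact Units.ext (norm_smul (w : 𝓞 K)).symm
  have hNt : N ((unitOneSub σ w)⁻¹ * ((u ^ k)⁻¹ * v)) = 1 := by simp [hNu, hNv, hNw]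
  have hodd : Odd (Module.finrank ℚ K) := hdeg ▸ hp.odd_of_ne_two hp2
  rw [zpowers_neg_one_eq_torsion hodd] at hw'
  -- Equality modulo sign leaves a factor `1` or `-1`; the latter has norm `-1`, while all units
  -- here have norm 1.
  rcases Units.torsion_eq_one_or_neg_one_of_odd_finrank hodd ⟨_, hw'⟩ with h | h
  · simp only at h
    rw [inv_mul_eq_one] at h
    rw [h]; simp
  · simp only at h
    rw [h] at hNt
    have h1 : N (-1) = -1 := Units.ext (by
      have := norm_neg hdeg hp hp2 (1 : K)
      simpa [N] using this)
    rw [h1] at hNt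
    exact absurd (congrArg Units.val hNt) (by norm_num)

end CyclicClassGroup

/-! ### Ramified and unramified primes in prime degree -/

namespace CyclicClassGroup
open scoped Pointwise

variable {K : Type*} [Field K] [NumberField K] {p : ℕ} {σ : Gal(K/ℚ)}

theorem smul_ideal_eq_of_forall_mem_zpowers (hσ : ∀ g : Gal(K/ℚ), g ∈ Subgroup.zpowers σ)
    {A : Ideal (𝓞 K)} (hA : σ • A = A) (g : Gal(K/ℚ)) : g • A = A :=
  (Subgroup.zpowers_le.2 (show σ ∈ MulAction.stabilizer Gal(K/ℚ) A from hA)) (hσ g)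

omit [NumberField K] in
theorem exists_prime_natCast_mem (P : HeightOneSpectrum (𝓞 K)) :
    ∃ q : ℕ, q.Prime ∧ (q : 𝓞 K) ∈ P.asIdeal := by
  have h0 : P.asIdeal.under ℤ ≠ ⊥ := Ideal.under_ne_bot ℤ P.ne_bot
  have hpr : (P.asIdeal.under ℤ).IsPrime := inferInstance
  obtain ⟨n, hn⟩ := IsPrincipalIdealRing.principal (P.asIdeal.under ℤ)
  have hn' : P.asIdeal.under ℤ = Ideal.span {n} := hn
  rw [hn'] at h0 hpr
  have hn0 : n ≠ 0 := by rintro rfl; simp at h0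
  have hnp : Prime n := (Ideal.span_singleton_prime hn0).1 hpr
  refine ⟨n.natAbs, Int.prime_iff_natAbs_prime.1 hnp, ?_⟩
  have h1 : (n.natAbs : ℤ) ∈ P.asIdeal.under ℤ := by
    rw [hn', Ideal.mem_span_singleton]
    exact Int.dvd_natAbs.2 dvd_rfl
  rw [Ideal.mem_under] at h1
  simpa using h1

omit [NumberField K] in
theorem liesOver_of_natCast_mem {P : Ideal (𝓞 K)} [P.IsPrime] {q : ℕ} (hq : q.Prime)
    (h : (q : 𝓞 K) ∈ P) : P.LiesOver (Ideal.span {(q : ℤ)}) :=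
  (Ideal.liesOver_span_iff ‹P.IsPrime›.ne_top (Nat.prime_iff_prime_int.1 hq)).2 (by simpa using h)

theorem exists_span_natCast_eq_prod {q : ℕ} (hq : q.Prime) :
    ∃ s : Finset (Ideal (𝓞 K)),
      (∀ Q, Q ∈ s ↔ Q ∈ (Ideal.span {(q : ℤ)}).primesOver (𝓞 K)) ∧
      Ideal.span {(q : 𝓞 K)} = ∏ Q ∈ s, Q ^ Q.ramificationIdx ℤ := by
  have hmax : (Ideal.span {(q : ℤ)}).IsMaximal :=
    have := Fact.mk hq; Int.ideal_span_isMaximal_of_prime q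
  refine ⟨_, fun Q => Set.mem_toFinset, ?_⟩
  rw [← Ideal.map_algebraMap_eq_finsetProd_pow, Ideal.map_span]
  · simp
  · simpa using hq.ne_zero

section Galois
variable [IsGalois ℚ K] (hdeg : Module.finrank ℚ K = p)

include hdeg in
-- In `e f g = p`, ramification excludes `e = 1`; hence `e = p` and `P` is the only prime above `q`.
theorem pow_eq_span_natCast_of_ramified (hp : p.Prime) {P : Ideal (𝓞 K)} [P.IsPrime]
    (hP : ¬ Algebra.IsUnramifiedAt ℤ P) {q : ℕ} (hq : q.Prime) (h : (q : 𝓞 K) ∈ P) :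
    P ^ p = Ideal.span {(q : 𝓞 K)} := by
  have hmax : (Ideal.span {(q : ℤ)}).IsMaximal :=
    have := Fact.mk hq; Int.ideal_span_isMaximal_of_prime q
  have := liesOver_of_natCast_mem hq h
  have hcard := Ideal.ncard_primesOver_mul_ramificationIdxIn_mul_inertiaDegIn
    (Ideal.span {(q : ℤ)}) (𝓞 K) Gal(K/ℚ)
  rw [IsGalois.card_aut_eq_finrank, hdeg,
    Ideal.ramificationIdxIn_eq_ramificationIdx _ P Gal(K/ℚ)] at hcard
  have he : P.ramificationIdx ℤ ≠ 1 := fun h => hP (Ideal.ramificationIdx_eq_one_iff.1 h)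
  have hep : P.ramificationIdx ℤ = p :=
    ((Nat.dvd_prime hp).1 (Dvd.intro_left (_ * _) (by rw [← hcard, mul_right_comm, mul_assoc]))).resolve_left he
  have hg : ((Ideal.span {(q : ℤ)}).primesOver (𝓞 K)).ncard = 1 := by
    rw [hep] at hcard
    have h1 : ((Ideal.span {(q : ℤ)}).primesOver (𝓞 K)).ncard *
      (Ideal.span {(q : ℤ)}).inertiaDegIn (𝓞 K) = 1 :=
      Nat.eq_of_mul_eq_mul_left hp.pos (by rw [mul_one, mul_left_comm, hcard])
    exact Nat.eq_one_of_mul_eq_one_right h1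
  obtain ⟨Q, hQ⟩ := Set.ncard_eq_one.1 hg
  have hPQ : P ∈ (Ideal.span {(q : ℤ)}).primesOver (𝓞 K) := ⟨inferInstance, inferInstance⟩
  have hPQ' : P = Q := by rw [hQ] at hPQ; exact hPQ
  obtain ⟨s, hs, hprod⟩ := exists_span_natCast_eq_prod (K := K) hq
  have hfin : s = {P} := by
    ext R; rw [hs, hQ, hPQ']; simp
  rw [hprod, hfin, Finset.prod_singleton, hep]

/-- Galois acts transitively on the primes above `q`, so all of them divide the invariant ideal `A`.
They are distinct and occur in `(q)` with exponent 1. -/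
theorem span_natCast_dvd_of_unramified {P : Ideal (𝓞 K)} [P.IsPrime]
    (hP : Algebra.IsUnramifiedAt ℤ P) {q : ℕ} (hq : q.Prime) (h : (q : 𝓞 K) ∈ P)
    {A : Ideal (𝓞 K)} (hA : ∀ g : Gal(K/ℚ), g • A = A) (hPA : P ∣ A) :
    Ideal.span {(q : 𝓞 K)} ∣ A := by
  have hmax : (Ideal.span {(q : ℤ)}).IsMaximal :=
    have := Fact.mk hq; Int.ideal_span_isMaximal_of_prime q
  have hq0 : Ideal.span {(q : ℤ)} ≠ ⊥ := by simpa using hq.ne_zero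
  have := liesOver_of_natCast_mem hq h
  obtain ⟨s, hs, hprod⟩ := exists_span_natCast_eq_prod (K := K) hq
  rw [hprod]
  rw [Finset.prod_congr rfl (g := fun Q => Q)]
  · apply Finset.prod_primes_dvd
    · intro Q hQ
      obtain ⟨h1, h2⟩ := (hs Q).1 hQ
      exact Ideal.prime_of_isPrime (Ideal.ne_bot_of_liesOver_of_ne_bot hq0 Q) h1
    · intro Q hQ
      obtain ⟨h1, h2⟩ := (hs Q).1 hQ
      obtain ⟨g, rfl⟩ := Ideal.exists_smul_eq_of_isGaloisGroup (Ideal.span {(q : ℤ)}) P Q Gal(K/ℚ)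
      rw [← hA g]
      obtain ⟨B, rfl⟩ := hPA
      exact ⟨g • B, smul_mul' g P B⟩
  · intro Q hQ
    obtain ⟨h1, h2⟩ := (hs Q).1 hQ
    rw [Ideal.ramificationIdx_eq_of_isGaloisGroup (Ideal.span {(q : ℤ)}) Q P Gal(K/ℚ),
      Ideal.ramificationIdx_eq_one_iff.2 hP, pow_one]

end Galois
end CyclicClassGroup

/-! ### Factorization of Galois-invariant ideals -/

namespace CyclicClassGroup
open scoped Pointwise nonZeroDivisors

variable {K : Type*} [Field K] [NumberField K] {p : ℕ} {σ : Gal(K/ℚ)}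

theorem smul_span_singleton (g : Gal(K/ℚ)) (x : 𝓞 K) :
    g • Ideal.span {x} = Ideal.span {g • x} := by
  rw [Ideal.pointwise_smul_def, Ideal.map_span, Set.image_singleton]; rfl

theorem smul_natCast (g : Gal(K/ℚ)) (n : ℕ) : g • (n : 𝓞 K) = n :=
  map_natCast (MulSemiringAction.toRingHom Gal(K/ℚ) (𝓞 K) g) n

theorem smul_span_natCast (g : Gal(K/ℚ)) (n : ℕ) :
    g • Ideal.span {(n : 𝓞 K)} = Ideal.span {(n : 𝓞 K)} := by
  rw [smul_span_singleton, smul_natCast]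

theorem span_natCast_ne_zero {n : ℕ} (hn : n ≠ 0) : Ideal.span {(n : 𝓞 K)} ≠ 0 := by
  simpa using hn

/-- The product of the ramified primes `P` to the powers `a P`. -/
def ramifiedProduct (a : ramifiedPrimeIdeals K →₀ ℕ) : Ideal (𝓞 K) :=
  a.prod fun P n => P.1.asIdeal ^ n

omit [NumberField K] in
@[simp]
theorem ramifiedProduct_zero : ramifiedProduct (0 : ramifiedPrimeIdeals K →₀ ℕ) = 1 :=
  Finsupp.prod_zero_index

omit [NumberField K] in
theorem ramifiedProduct_add (a b : ramifiedPrimeIdeals K →₀ ℕ) :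
    ramifiedProduct (a + b) = ramifiedProduct a * ramifiedProduct b :=
  Finsupp.prod_add_index' (fun _ => pow_zero _) fun _ _ _ => pow_add _ _ _

omit [NumberField K] in
@[simp]
theorem ramifiedProduct_single (P : ramifiedPrimeIdeals K) (n : ℕ) :
    ramifiedProduct (Finsupp.single P n) = P.1.asIdeal ^ n :=
  Finsupp.prod_single_index (pow_zero _)

omit [NumberField K] in
theorem ramifiedProduct_ne_zero (a : ramifiedPrimeIdeals K →₀ ℕ) : ramifiedProduct a ≠ 0 :=
  Finset.prod_ne_zero_iff.2 fun P _ => pow_ne_zero _ P.1.ne_bot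

theorem ramifiedProductClass_add (e f : ramifiedPrimeIdeals K →₀ ℤ) :
    ramifiedProductClass (e + f) = ramifiedProductClass e * ramifiedProductClass f :=
  Finsupp.prod_add_index' (fun _ => zpow_zero _) fun _ _ _ => zpow_add _ _ _

theorem ramifiedProductClass_single (P : ramifiedPrimeIdeals K) (n : ℤ) :
    ramifiedProductClass (Finsupp.single P n) = primeClass P.1 ^ n :=
  Finsupp.prod_single_index (zpow_zero _)

theorem mk0_ramifiedProduct (a : ramifiedPrimeIdeals K →₀ ℕ)
    (h : ramifiedProduct a ∈ (Ideal (𝓞 K))⁰) :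
    ClassGroup.mk0 ⟨ramifiedProduct a, h⟩ =
      ramifiedProductClass (a.mapRange (fun n : ℕ => (n : ℤ)) Nat.cast_zero) := by
  have h1 : (⟨ramifiedProduct a, h⟩ : (Ideal (𝓞 K))⁰) = a.prod fun P n =>
      (⟨P.1.asIdeal, mem_nonZeroDivisors_iff_ne_zero.mpr P.1.ne_bot⟩ : (Ideal (𝓞 K))⁰) ^ n := by
    apply Subtype.ext
    simp [ramifiedProduct, Finsupp.prod]
  rw [h1, map_finsuppProd, ramifiedProductClass, Finsupp.prod_mapRange_index]
  · refine Finsupp.prod_congr fun P _ => ?_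
    rw [map_pow, zpow_natCast]; rfl
  · simp

open UniqueFactorizationMonoid in
/-- The exponent of a prime in the factorization of an ideal. -/
def primeExponent (P : HeightOneSpectrum (𝓞 K)) (A : Ideal (𝓞 K)) : ℕ :=
  haveI := Classical.decEq (Ideal (𝓞 K))
  (normalizedFactors A).count P.asIdeal

open UniqueFactorizationMonoid in
theorem primeExponent_mul (P : HeightOneSpectrum (𝓞 K)) {A B : Ideal (𝓞 K)} (hA : A ≠ 0)
    (hB : B ≠ 0) : primeExponent P (A * B) = primeExponent P A + primeExponent P B := by
  rw [primeExponent, normalizedFactors_mul hA hB, Multiset.count_add]; rfl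

open UniqueFactorizationMonoid in
theorem primeExponent_one (P : HeightOneSpectrum (𝓞 K)) : primeExponent P 1 = 0 := by
  rw [primeExponent, normalizedFactors_one]; rfl

open UniqueFactorizationMonoid in
theorem primeExponent_pow_asIdeal (P Q : HeightOneSpectrum (𝓞 K)) (n : ℕ) [Decidable (P = Q)] :
    primeExponent P (Q.asIdeal ^ n) = if P = Q then n else 0 := by
  classical
  rw [primeExponent, normalizedFactors_pow, normalizedFactors_irreducible Q.irreducible,
    normalize_eq, Multiset.nsmul_singleton, Multiset.count_replicate]
  simp [HeightOneSpectrum.ext_iff, eq_comm]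

open UniqueFactorizationMonoid in
theorem primeExponent_eq_zero (P : HeightOneSpectrum (𝓞 K)) {A : Ideal (𝓞 K)}
    (h : ¬ A ≤ P.asIdeal) : primeExponent P A = 0 := by
  rw [primeExponent, Multiset.count_eq_zero]
  exact fun hP => h (Ideal.le_of_dvd (dvd_of_mem_normalizedFactors hP))

theorem primeExponent_ramifiedProduct (P : ramifiedPrimeIdeals K)
    (a : ramifiedPrimeIdeals K →₀ ℕ) : primeExponent P.1 (ramifiedProduct a) = a P := by
  classical
  induction a using Finsupp.induction_linear with
  | zero => rw [ramifiedProduct_zero, primeExponent_one]; rfl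
  | add a b ha hb =>
    rw [ramifiedProduct_add, primeExponent_mul _ (ramifiedProduct_ne_zero _)
      (ramifiedProduct_ne_zero _), ha, hb, Finsupp.add_apply]
  | single Q n =>
    rw [ramifiedProduct_single, primeExponent_pow_asIdeal, Finsupp.single_apply]
    simp [Subtype.ext_iff, eq_comm]

section Galois
variable [IsGalois ℚ K] (hp : p.Prime) (hdeg : Module.finrank ℚ K = p)
include hp hdeg

theorem exists_prime_pow_eq_span (P : ramifiedPrimeIdeals K) :
    ∃ q : ℕ, q.Prime ∧ P.1.asIdeal ^ p = Ideal.span {(q : 𝓞 K)} := by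
  obtain ⟨q, hq, hqP⟩ := exists_prime_natCast_mem P.1
  exact ⟨q, hq, pow_eq_span_natCast_of_ramified hdeg hp P.2 hq hqP⟩

theorem primeClass_pow (P : ramifiedPrimeIdeals K) : primeClass P.1 ^ p = 1 := by
  obtain ⟨q, hq, h⟩ := exists_prime_pow_eq_span hp hdeg P
  rw [primeClass, ← map_pow, SubmonoidClass.mk_pow, ClassGroup.mk0_eq_one_iff, h]
  exact ⟨⟨_, rfl⟩⟩

theorem smul_asIdeal_of_ramified (P : ramifiedPrimeIdeals K) (g : Gal(K/ℚ)) :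
    g • P.1.asIdeal = P.1.asIdeal := by
  obtain ⟨q, hq, h⟩ := exists_prime_pow_eq_span hp hdeg P
  have hdvd : ∀ g : Gal(K/ℚ), P.1.asIdeal ∣ g • P.1.asIdeal := by
    intro g
    apply P.1.prime.dvd_of_dvd_pow (n := p)
    rw [← smul_pow', h, smul_span_natCast, ← h]
    exact dvd_pow_self _ hp.ne_zero
  refine dvd_antisymm ?_ (hdvd g)
  obtain ⟨B, hB⟩ := hdvd g⁻¹
  exact ⟨g • B, by rw [← smul_mul', ← hB, smul_inv_smul]⟩

/-- A prime factor of `n` contributes `p` if it lies below `P`, and 0 otherwise. -/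
theorem dvd_primeExponent_span_natCast (P : ramifiedPrimeIdeals K) {n : ℕ} (hn : n ≠ 0) :
    p ∣ primeExponent P.1 (Ideal.span {(n : 𝓞 K)}) := by
  classical
  induction n using induction_on_primes with
  | zero => exact absurd rfl hn
  | one => simp [primeExponent_one, ← Ideal.one_eq_top]
  | prime_mul q m hq ih =>
    have hm : m ≠ 0 := right_ne_zero_of_mul hn
    rw [Nat.cast_mul, ← Ideal.span_singleton_mul_span_singleton,
      primeExponent_mul _ (span_natCast_ne_zero hq.ne_zero) (span_natCast_ne_zero hm)]
    refine dvd_add ?_ (ih hm)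
    by_cases h : (q : 𝓞 K) ∈ P.1.asIdeal
    · rw [← pow_eq_span_natCast_of_ramified hdeg hp P.2 hq h, primeExponent_pow_asIdeal, if_pos rfl]
    · rw [primeExponent_eq_zero]
      · exact dvd_zero _
      · rwa [Ideal.span_singleton_le_iff_mem]

/-- Induction on divisibility: an invariant ideal can be divided by a ramified prime, or by the
whole of `(q)` for an unramified one, and stays invariant. -/
theorem exists_eq_span_natCast_mul_ramifiedProduct {A : Ideal (𝓞 K)} (hA0 : A ≠ 0)
    (hA : ∀ g : Gal(K/ℚ), g • A = A) :
    ∃ n : ℕ, n ≠ 0 ∧ ∃ a : ramifiedPrimeIdeals K →₀ ℕ,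
      A = Ideal.span {(n : 𝓞 K)} * ramifiedProduct a := by
  revert hA0 hA
  refine WellFounded.induction (C := fun A : Ideal (𝓞 K) => A ≠ 0 → (∀ g : Gal(K/ℚ), g • A = A) →
    ∃ n : ℕ, n ≠ 0 ∧ ∃ a : ramifiedPrimeIdeals K →₀ ℕ,
      A = Ideal.span {(n : 𝓞 K)} * ramifiedProduct a) wellFounded_dvdNotUnit A ?_
  intro A ih hA0 hA
  by_cases hu : IsUnit A
  · refine ⟨1, one_ne_zero, 0, ?_⟩
    rw [Ideal.isUnit_iff] at hu
    simp [hu, Ideal.one_eq_top]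
  obtain ⟨P, hPirr, hPA⟩ := WfDvdMonoid.exists_irreducible_factor hu hA0
  have hPp : Prime P := hPirr.prime
  have : P.IsPrime := Ideal.isPrime_of_prime hPp
  have key : ∀ I B : Ideal (𝓞 K), (∀ g : Gal(K/ℚ), g • I = I) → ¬ IsUnit I → A = I * B →
      B ≠ 0 ∧ (∀ g : Gal(K/ℚ), g • B = B) ∧ DvdNotUnit B A := by
    intro I B hI hIu hAB
    have hI0 : I ≠ 0 := by rintro rfl; simp [hAB] at hA0
    have hB0 : B ≠ 0 := by rintro rfl; simp [hAB] at hA0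
    refine ⟨hB0, fun g => ?_, hB0, I, hIu, by rw [hAB, mul_comm]⟩
    have h := hA g
    rw [hAB, smul_mul', hI] at h
    exact mul_left_cancel₀ hI0 h
  by_cases hur : Algebra.IsUnramifiedAt ℤ P
  · obtain ⟨q, hq, hqP⟩ := exists_prime_natCast_mem ⟨P, this, hPp.ne_zero⟩
    obtain ⟨B, hB⟩ := span_natCast_dvd_of_unramified hur hq hqP hA hPA
    obtain ⟨h1, h2, h3⟩ := key _ B (fun g => smul_span_natCast g q) (by
      rw [Ideal.isUnit_iff]
      intro h
      have : Ideal.span {(q : 𝓞 K)} ≤ P := by rwa [Ideal.span_singleton_le_iff_mem]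
      exact ‹P.IsPrime›.ne_top (top_le_iff.1 (h ▸ this))) hB
    obtain ⟨n, hn, a, ha⟩ := ih B h3 h1 h2
    refine ⟨q * n, mul_ne_zero hq.ne_zero hn, a, ?_⟩
    rw [hB, ha, Nat.cast_mul, ← Ideal.span_singleton_mul_span_singleton, mul_assoc]
  · let P' : ramifiedPrimeIdeals K := ⟨⟨P, this, hPp.ne_zero⟩, hur⟩
    obtain ⟨B, hB⟩ := hPA
    obtain ⟨h1, h2, h3⟩ := key _ B (smul_asIdeal_of_ramified hp hdeg P') hPp.not_isUnit hB
    obtain ⟨n, hn, a, ha⟩ := ih B h3 h1 h2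
    refine ⟨n, hn, a + Finsupp.single P' 1, ?_⟩
    rw [hB, ha, ramifiedProduct_add, ramifiedProduct_single, pow_one]
    ring

theorem exists_ramifiedProduct_nsmul_eq_span (b : ramifiedPrimeIdeals K →₀ ℕ) :
    ∃ m : ℕ, m ≠ 0 ∧ ramifiedProduct (p • b) = Ideal.span {(m : 𝓞 K)} := by
  induction b using Finsupp.induction_linear with
  | zero => exact ⟨1, one_ne_zero, by simp [Ideal.one_eq_top]⟩
  | add a b ha hb =>
    obtain ⟨m, hm, h⟩ := ha
    obtain ⟨n, hn, h'⟩ := hb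
    refine ⟨m * n, mul_ne_zero hm hn, ?_⟩
    rw [smul_add, ramifiedProduct_add, h, h', Ideal.span_singleton_mul_span_singleton, Nat.cast_mul]
  | single P n =>
    obtain ⟨q, hq, h⟩ := exists_prime_pow_eq_span hp hdeg P
    refine ⟨q ^ n, pow_ne_zero _ hq.ne_zero, ?_⟩
    rw [Finsupp.smul_single, ramifiedProduct_single, smul_eq_mul, pow_mul, h,
      Ideal.span_singleton_pow, Nat.cast_pow]

theorem exists_eq_span_natCast_mul_ramifiedProduct_lt {A : Ideal (𝓞 K)} (hA0 : A ≠ 0)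
    (hA : ∀ g : Gal(K/ℚ), g • A = A) :
    ∃ n : ℕ, n ≠ 0 ∧ ∃ a : ramifiedPrimeIdeals K →₀ ℕ, (∀ P, a P < p) ∧
      A = Ideal.span {(n : 𝓞 K)} * ramifiedProduct a := by
  obtain ⟨n, hn, a, rfl⟩ := exists_eq_span_natCast_mul_ramifiedProduct hp hdeg hA0 hA
  -- The exponents are divided by `p` with remainder; the quotient part is absorbed into the
  -- rational integer.
  obtain ⟨m, hm, h⟩ := exists_ramifiedProduct_nsmul_eq_span hp hdeg
    (a.mapRange (· / p) (Nat.zero_div p))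
  refine ⟨n * m, mul_ne_zero hn hm, a.mapRange (· % p) (Nat.zero_mod p),
    fun P => Nat.mod_lt _ hp.pos, ?_⟩
  have ha : a = p • a.mapRange (· / p) (Nat.zero_div p) + a.mapRange (· % p) (Nat.zero_mod p) := by
    ext P; simp [Nat.div_add_mod]
  conv_lhs => rw [ha]
  rw [ramifiedProduct_add, h, Nat.cast_mul, ← Ideal.span_singleton_mul_span_singleton, mul_assoc]

theorem modEq_of_span_mul_ramifiedProduct_eq {m n : ℤ} (hm : m ≠ 0) (hn : n ≠ 0)
    {a b : ramifiedPrimeIdeals K →₀ ℕ}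
    (h : Ideal.span {(m : 𝓞 K)} * ramifiedProduct a = Ideal.span {(n : 𝓞 K)} * ramifiedProduct b)
    (P : ramifiedPrimeIdeals K) : a P ≡ b P [MOD p] := by
  have hspan : ∀ k : ℤ, Ideal.span {(k : 𝓞 K)} = Ideal.span {((k.natAbs : ℕ) : 𝓞 K)} := by
    intro k
    rw [Ideal.span_singleton_eq_span_singleton]
    have := (Int.associated_natAbs k).map (algebraMap ℤ (𝓞 K))
    simpa using this
  rw [hspan, hspan] at h
  have hm' := Int.natAbs_ne_zero.2 hm
  have hn' := Int.natAbs_ne_zero.2 hn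
  have h1 := congrArg (primeExponent P.1) h
  rw [primeExponent_mul _ (span_natCast_ne_zero hm') (ramifiedProduct_ne_zero _),
    primeExponent_mul _ (span_natCast_ne_zero hn') (ramifiedProduct_ne_zero _),
    primeExponent_ramifiedProduct, primeExponent_ramifiedProduct] at h1
  have h2 := dvd_primeExponent_span_natCast hp hdeg P hm'
  have h3 := dvd_primeExponent_span_natCast hp hdeg P hn'
  have h4 := (Nat.modEq_zero_iff_dvd.2 h2).add_right (a P)
  have h5 := (Nat.modEq_zero_iff_dvd.2 h3).add_right (b P)
  rw [zero_add] at h4 h5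
  exact h4.symm.trans (h1 ▸ h5)

end Galois
end CyclicClassGroup

/-! ### Invariant classes contain invariant ideals -/

open scoped Pointwise nonZeroDivisors

theorem FractionalIdeal.ringEquivOfRingEquiv_coeIdeal {R S : Type*} (K L : Type*) [CommRing R]
    [IsDomain R] [CommRing S] [IsDomain S] [CommRing K] [CommRing L] [Algebra R K] [Algebra S L]
    [IsFractionRing R K] [IsFractionRing S L] (f : R ≃+* S) (I : Ideal R) :
    FractionalIdeal.ringEquivOfRingEquiv K L f (I : FractionalIdeal R⁰ K) =
      ((I.map f : Ideal S) : FractionalIdeal S⁰ L) := by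
  ext x
  rw [FractionalIdeal.mem_coeIdeal]
  constructor
  · rintro ⟨y, hy, rfl⟩
    obtain ⟨i, hi, rfl⟩ := hy
    exact ⟨f i, Ideal.mem_map_of_mem f hi,
      (IsFractionRing.ringEquivOfRingEquiv_algebraMap f i).symm⟩
  · rintro ⟨j, hj, rfl⟩
    obtain ⟨i, hi, rfl⟩ := (Ideal.mem_map_of_equiv f j).1 hj
    exact ⟨algebraMap R K i, ⟨i, hi, rfl⟩, IsFractionRing.ringEquivOfRingEquiv_algebraMap f i⟩

theorem ClassGroup.mulEquiv_mk0 {R R' : Type*} [CommRing R] [IsDedekindDomain R]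
    [CommRing R'] [IsDedekindDomain R'] (f : R ≃+* R') (I : (Ideal R)⁰)
    (h : (I : Ideal R).map f ∈ (Ideal R')⁰) :
    ClassGroup.mulEquiv f (ClassGroup.mk0 I) = ClassGroup.mk0 ⟨(I : Ideal R).map f, h⟩ := by
  unfold ClassGroup.mulEquiv
  simp only [MulEquiv.trans_apply]
  rw [MulEquiv.symm_apply_eq, ClassGroup.equiv_mk0, ClassGroup.equiv_mk0]
  refine congrArg (QuotientGroup.mk' _) (Units.ext ?_)
  exact FractionalIdeal.ringEquivOfRingEquiv_coeIdeal _ _ f (I : Ideal R)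

namespace CyclicClassGroup

variable {K : Type*} [Field K] [NumberField K] {p : ℕ} {σ : Gal(K/ℚ)}

theorem smul_ideal_mem_nonZeroDivisors (g : Gal(K/ℚ)) {I : Ideal (𝓞 K)} (hI : I ∈ (Ideal (𝓞 K))⁰) :
    g • I ∈ (Ideal (𝓞 K))⁰ := by
  rw [mem_nonZeroDivisors_iff_ne_zero] at hI ⊢
  intro h
  apply hI
  rw [← inv_smul_smul g I, h, Ideal.zero_eq_bot, Ideal.pointwise_smul_def, Ideal.map_bot]

theorem galoisClassAction_mk0 (g : Gal(K/ℚ)) (I : (Ideal (𝓞 K))⁰) :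
    galoisClassAction K g (ClassGroup.mk0 I) =
      ClassGroup.mk0 ⟨g • (I : Ideal (𝓞 K)), smul_ideal_mem_nonZeroDivisors g I.2⟩ := by
  have h : (I : Ideal (𝓞 K)).map (MulSemiringAction.toRingEquiv Gal(K/ℚ) (𝓞 K) g) =
    g • (I : Ideal (𝓞 K)) := rfl
  have h' := smul_ideal_mem_nonZeroDivisors g I.2
  rw [← h] at h'
  rw [galoisClassAction, ClassGroup.mulEquiv_mk0 _ I h']
  exact congrArg ClassGroup.mk0 (Subtype.ext h)

theorem mem_invariantClasses {c : ClassGroup (𝓞 K)} :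
    c ∈ invariantClasses K ↔ ∀ g : Gal(K/ℚ), galoisClassAction K g c = c := by
  rw [invariantClasses, Subgroup.mem_iInf]; rfl

theorem absNorm_smul (g : Gal(K/ℚ)) (I : Ideal (𝓞 K)) :
    Ideal.absNorm (g • I) = Ideal.absNorm I :=
  (Nat.card_congr (Ideal.quotientEquiv I (g • I)
    (MulSemiringAction.toRingEquiv Gal(K/ℚ) (𝓞 K) g) rfl).toEquiv).symm

theorem exists_invariant_ideal [IsGalois ℚ K] (hp : p.Prime) (hp2 : p ≠ 2)
    (hdeg : Module.finrank ℚ K = p) (hσ : ∀ g : Gal(K/ℚ), g ∈ Subgroup.zpowers σ)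
    {c : ClassGroup (𝓞 K)} (hc : c ∈ invariantClasses K) :
    ∃ A : (Ideal (𝓞 K))⁰, ClassGroup.mk0 A = c ∧ ∀ g : Gal(K/ℚ), g • (A : Ideal (𝓞 K)) = A := by
  obtain ⟨I, rfl⟩ := ClassGroup.mk0_surjective c
  have h := mem_invariantClasses.1 hc σ
  rw [galoisClassAction_mk0, ClassGroup.mk0_eq_mk0_iff] at h
  obtain ⟨x, y, hx, hy, hxy⟩ := h
  simp only at hxy
  have hI0 : (I : Ideal (𝓞 K)) ≠ 0 := nonZeroDivisors.coe_ne_zero I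
  have hN : |Algebra.norm ℚ (x : K)| = |Algebra.norm ℚ (y : K)| := by
    have h1 := congrArg Ideal.absNorm hxy
    rw [map_mul, map_mul, absNorm_smul, Ideal.absNorm_span_singleton,
      Ideal.absNorm_span_singleton] at h1
    have h2 := Nat.eq_of_mul_eq_mul_right (Nat.pos_of_ne_zero (Ideal.absNorm_eq_zero_iff.not.2 hI0)) h1
    rw [← Algebra.coe_norm_int, ← Algebra.coe_norm_int, ← Int.cast_abs, ← Int.cast_abs,
      Int.abs_eq_natAbs, Int.abs_eq_natAbs, h2]
  -- Ideal norms determine element norms only up to sign; odd degree lets `-y` replace `y`.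
  obtain ⟨y', hy', hyy', hN'⟩ : ∃ y' : 𝓞 K, y' ≠ 0 ∧ Ideal.span {y'} = Ideal.span {y} ∧
      Algebra.norm ℚ (x : K) = Algebra.norm ℚ (y' : K) := by
    rcases abs_eq_abs.1 hN with h | h
    · exact ⟨y, hy, rfl, h⟩
    · refine ⟨-y, neg_ne_zero.2 hy, Ideal.span_singleton_neg y, ?_⟩
      have : ((-y : 𝓞 K) : K) = -(y : K) := map_neg _ _
      rw [this, norm_neg hdeg hp hp2, h]
  rw [← hyy'] at hxy
  obtain ⟨z, hz, hzz⟩ := exists_mul_smul_eq_mul_of_norm_eq hdeg hσ hx hN'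
  have hz0 : Ideal.span {z} ≠ 0 := by simpa using hz
  refine ⟨⟨Ideal.span {z}, mem_nonZeroDivisors_iff_ne_zero.2 hz0⟩ * I, ?_, ?_⟩
  · rw [map_mul, (ClassGroup.mk0_eq_one_iff _).2 ⟨⟨z, rfl⟩⟩, one_mul]
  · apply smul_ideal_eq_of_forall_mem_zpowers hσ
    have hx0 : Ideal.span {x} ≠ 0 := by simpa using hx
    apply mul_left_cancel₀ hx0
    simp only [Submonoid.coe_mul]
    rw [smul_mul', smul_span_singleton, mul_left_comm, hxy, ← mul_assoc,
      Ideal.span_singleton_mul_span_singleton, mul_comm (σ • z), hzz,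
      ← Ideal.span_singleton_mul_span_singleton, mul_assoc]

end CyclicClassGroup

/-! ### Generators, relations and the order of the invariant class group -/

namespace CyclicClassGroup
open scoped Pointwise nonZeroDivisors

variable {K : Type*} [Field K] [NumberField K] {p : ℕ} {σ : Gal(K/ℚ)}

theorem finite_ramifiedRationalPrimes : (ramifiedRationalPrimes K).Finite := by
  have h0 : discr K ≠ 0 := discr_ne_zero K
  refine (Nat.divisors (discr K).natAbs).finite_toSet.subset fun q hq => ?_
  obtain ⟨hq, hr⟩ := hq
  rw [← not_dvd_discr_iff_isUnramifiedIn K (𝓞 K) (Nat.prime_iff_prime_int.1 hq), not_not] at hr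
  simpa [h0] using Int.natCast_dvd.1 hr

/-- The homomorphism from exponent vectors to ideal classes given by the ramified primes. -/
def ramifiedProductClassHom (K : Type*) [Field K] [NumberField K] :
    (ramifiedPrimeIdeals K →₀ ℤ) →+ Additive (ClassGroup (𝓞 K)) :=
  AddMonoidHom.mk' (fun e => Additive.ofMul (ramifiedProductClass e)) fun e f =>
    congrArg Additive.ofMul (ramifiedProductClass_add e f)

theorem ramifiedProductClass_zsmul (k : ℤ) (e : ramifiedPrimeIdeals K →₀ ℤ) :
    ramifiedProductClass (k • e) = ramifiedProductClass e ^ k :=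
  map_zsmul (ramifiedProductClassHom K) k e

section Galois
variable [IsGalois ℚ K] (hp : p.Prime) (hdeg : Module.finrank ℚ K = p)
include hp hdeg

theorem nonempty_ramifiedPrimeIdeals_equiv :
    Nonempty (ramifiedPrimeIdeals K ≃ ramifiedRationalPrimes K) := by
  choose f hf hfP using exists_prime_pow_eq_span (K := K) hp hdeg
  have hfmem : ∀ P, (f P : 𝓞 K) ∈ P.1.asIdeal := by
    intro P
    have h1 : (f P : 𝓞 K) ∈ P.1.asIdeal ^ p := by
      rw [hfP]; exact Ideal.mem_span_singleton_self _
    exact Ideal.pow_le_self hp.ne_zero h1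
  have hmem : ∀ P, f P ∈ ramifiedRationalPrimes K := fun P =>
    ⟨hf P, fun h => P.2 (h _ inferInstance (liesOver_of_natCast_mem (hf P) (hfmem P)))⟩
  refine ⟨Equiv.ofBijective (fun P => (⟨f P, hmem P⟩ : ramifiedRationalPrimes K))
    ⟨fun P Q h => ?_, fun q => ?_⟩⟩
  · have h' : f P = f Q := congrArg Subtype.val h
    have h1 : P.1.asIdeal ^ p = Q.1.asIdeal ^ p := by rw [hfP, hfP, h']
    have h2 : P.1.asIdeal ∣ Q.1.asIdeal :=
      P.1.prime.dvd_of_dvd_pow (h1 ▸ dvd_pow_self _ hp.ne_zero)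
    have h3 : Q.1.asIdeal ∣ P.1.asIdeal :=
      Q.1.prime.dvd_of_dvd_pow (h1.symm ▸ dvd_pow_self _ hp.ne_zero)
    exact Subtype.ext (HeightOneSpectrum.ext (dvd_antisymm h2 h3))
  · obtain ⟨q, hq, hr⟩ := q
    unfold Algebra.IsUnramifiedIn at hr
    push Not at hr
    obtain ⟨P, hP, hPq, hr⟩ := hr
    have hq0 : Ideal.span {(q : ℤ)} ≠ ⊥ := by simpa using hq.ne_zero
    let P' : ramifiedPrimeIdeals K := ⟨⟨P, hP, Ideal.ne_bot_of_liesOver_of_ne_bot hq0 P⟩, hr⟩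
    refine ⟨P', Subtype.ext ?_⟩
    have h1 := (liesOver_of_natCast_mem (hf P') (hfmem P')).over.trans hPq.over.symm
    rw [Ideal.span_singleton_eq_span_singleton, Int.associated_iff_natAbs] at h1
    exact h1

theorem finite_ramifiedPrimeIdeals : Finite (ramifiedPrimeIdeals K) := by
  obtain ⟨e⟩ := nonempty_ramifiedPrimeIdeals_equiv (K := K) hp hdeg
  have : Finite (ramifiedRationalPrimes K) := finite_ramifiedRationalPrimes
  exact Finite.of_equiv _ e.symm

theorem ncard_ramifiedRationalPrimes :
    (ramifiedRationalPrimes K).ncard = Nat.card (ramifiedPrimeIdeals K) := by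
  obtain ⟨e⟩ := nonempty_ramifiedPrimeIdeals_equiv (K := K) hp hdeg
  rw [← Nat.card_coe_set_eq, Nat.card_congr e]

theorem ramifiedProductClass_pow (e : ramifiedPrimeIdeals K →₀ ℤ) :
    ramifiedProductClass e ^ p = 1 := by
  induction e using Finsupp.induction_linear with
  | zero => rw [ramifiedProductClass, Finsupp.prod_zero_index, one_pow]
  | add e f he hf => rw [ramifiedProductClass_add, mul_pow, he, hf, one_mul]
  | single P n =>
    rw [ramifiedProductClass_single, ← zpow_natCast, zpow_comm, zpow_natCast,
      primeClass_pow hp hdeg, one_zpow]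

theorem ramifiedProductClass_congr {e f : ramifiedPrimeIdeals K →₀ ℤ}
    (h : ∀ P, e P ≡ f P [ZMOD (p : ℤ)]) : ramifiedProductClass e = ramifiedProductClass f := by
  have : e = (p : ℤ) • (e - f).mapRange (· / (p : ℤ)) (Int.zero_ediv _) + f := by
    ext P
    have := Int.mul_ediv_cancel' (h P).symm.dvd
    simp only [Finsupp.add_apply, Finsupp.smul_apply, Finsupp.mapRange_apply, Finsupp.sub_apply,
      smul_eq_mul]
    rw [this]; ring
  rw [this, ramifiedProductClass_add, ramifiedProductClass_zsmul, zpow_natCast,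
    ramifiedProductClass_pow hp hdeg, one_mul]

theorem exists_mk0_ramifiedProduct_eq (e : ramifiedPrimeIdeals K →₀ ℤ) :
    ∃ b : ramifiedPrimeIdeals K →₀ ℕ, (∀ P, (b P : ℤ) ≡ e P [ZMOD (p : ℤ)]) ∧
      ClassGroup.mk0 ⟨ramifiedProduct b, mem_nonZeroDivisors_iff_ne_zero.2
        (ramifiedProduct_ne_zero b)⟩ = ramifiedProductClass e := by
  have hp0 : (p : ℤ) ≠ 0 := by exact_mod_cast hp.ne_zero
  have hb : ∀ P, (((e.mapRange (fun n => (n % (p : ℤ)).toNat) (by simp)) P : ℕ) : ℤ) ≡ e P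
      [ZMOD (p : ℤ)] := by
    intro P
    rw [Finsupp.mapRange_apply, Int.toNat_of_nonneg (Int.emod_nonneg _ hp0)]
    exact Int.mod_modEq _ _
  refine ⟨_, hb, ?_⟩
  rw [mk0_ramifiedProduct]
  exact ramifiedProductClass_congr hp hdeg hb

theorem primeClass_mem_invariantClasses (P : ramifiedPrimeIdeals K) :
    primeClass P.1 ∈ invariantClasses K := by
  rw [mem_invariantClasses]
  intro g
  rw [primeClass, galoisClassAction_mk0]
  exact congrArg ClassGroup.mk0 (Subtype.ext (smul_asIdeal_of_ramified hp hdeg P g))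

theorem mem_invariantClasses_iff_exists_ramifiedProductClass (hp2 : p ≠ 2)
    (hσ : ∀ g : Gal(K/ℚ), g ∈ Subgroup.zpowers σ) {c : ClassGroup (𝓞 K)} :
    c ∈ invariantClasses K ↔ ∃ e, ramifiedProductClass e = c := by
  constructor
  · intro hc
    obtain ⟨A, rfl, hA⟩ := exists_invariant_ideal hp hp2 hdeg hσ hc
    obtain ⟨n, hn, a, ha⟩ := exists_eq_span_natCast_mul_ramifiedProduct hp hdeg
      (nonZeroDivisors.coe_ne_zero A) hA
    refine ⟨_, (mk0_ramifiedProduct a (mem_nonZeroDivisors_iff_ne_zero.2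
      (ramifiedProduct_ne_zero a))).symm.trans ?_⟩
    have hA' : A = ⟨Ideal.span {(n : 𝓞 K)}, mem_nonZeroDivisors_iff_ne_zero.2
        (span_natCast_ne_zero hn)⟩ * ⟨ramifiedProduct a, mem_nonZeroDivisors_iff_ne_zero.2
        (ramifiedProduct_ne_zero a)⟩ := Subtype.ext ha
    rw [hA', map_mul, (ClassGroup.mk0_eq_one_iff _).2 ⟨⟨_, rfl⟩⟩, one_mul]
  · rintro ⟨e, rfl⟩
    exact Subgroup.prod_mem _ fun P _ =>
      Subgroup.zpow_mem _ (primeClass_mem_invariantClasses hp hdeg P) _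

theorem invariantClasses_eq_closure (hp2 : p ≠ 2)
    (hσ : ∀ g : Gal(K/ℚ), g ∈ Subgroup.zpowers σ) :
    invariantClasses K = Subgroup.closure (primeClass '' ramifiedPrimeIdeals K) := by
  apply le_antisymm
  · intro c hc
    obtain ⟨e, rfl⟩ := (mem_invariantClasses_iff_exists_ramifiedProductClass hp hdeg hp2 hσ).1 hc
    exact Subgroup.prod_mem _ fun P _ => Subgroup.zpow_mem _
      (Subgroup.subset_closure (Set.mem_image_of_mem primeClass P.2)) _
  · rw [Subgroup.closure_le]
    rintro _ ⟨P, hP, rfl⟩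
    exact primeClass_mem_invariantClasses hp hdeg ⟨P, hP⟩

/-- Hilbert 90 gives `z` with `σz = u z`. The ideal `(z)` is invariant, and removing its rational
factor leaves a product of ramified primes without affecting the equation. -/
theorem exists_relation (hσ : ∀ g : Gal(K/ℚ), g ∈ Subgroup.zpowers σ)
    {u : (𝓞 K)ˣ} (hu : (u : UnitsModSign K) ∉ (unitsModSignOneSub σ).range)
    (hun : Algebra.norm ℚ ((u : 𝓞 K) : K) = 1) :
    ∃ (x : 𝓞 K) (a : ramifiedPrimeIdeals K →₀ ℕ), x ≠ 0 ∧ σ • x = (u : 𝓞 K) * x ∧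
      (∀ P, a P < p) ∧ a ≠ 0 ∧ Ideal.span {x} = ramifiedProduct a := by
  obtain ⟨z, hz, hzu⟩ := exists_mul_smul_eq_mul_of_norm_eq (y := 1) hdeg hσ u.ne_zero
    (hun.trans ((congrArg _ (map_one (algebraMap (𝓞 K) K))).trans (map_one _)).symm)
  rw [one_mul] at hzu
  have hz0 : Ideal.span {z} ≠ 0 := by simpa using hz
  have hinv : σ • Ideal.span {z} = Ideal.span {z} := by
    rw [smul_span_singleton, hzu, Ideal.span_singleton_mul_left_unit u.isUnit]
  obtain ⟨n, hn, a, ha, hza⟩ := exists_eq_span_natCast_mul_ramifiedProduct_lt hp hdeg hz0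
    (smul_ideal_eq_of_forall_mem_zpowers hσ hinv)
  have hn' : (n : 𝓞 K) ≠ 0 := by exact_mod_cast hn
  obtain ⟨x, rfl⟩ : (n : 𝓞 K) ∣ z := by
    rw [← Ideal.span_singleton_le_span_singleton, hza]
    exact Ideal.mul_le_left
  rw [← Ideal.span_singleton_mul_span_singleton] at hza
  have hxa := mul_left_cancel₀ (span_natCast_ne_zero hn) hza
  have hσx : σ • x = (u : 𝓞 K) * x := by
    rw [smul_mul', smul_natCast, mul_left_comm] at hzu
    exact mul_left_cancel₀ hn' hzu
  refine ⟨x, a, right_ne_zero_of_mul hz, hσx, ha, ?_, hxa⟩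
  -- With zero exponents `x` would be a unit `w`, and `u = w⁻¹ / σ(w⁻¹)` would lie in the excluded
  -- image.
  rintro rfl
  rw [ramifiedProduct_zero, Ideal.one_eq_top, Ideal.span_singleton_eq_top] at hxa
  obtain ⟨w, rfl⟩ := hxa
  refine hu ⟨((w⁻¹ : (𝓞 K)ˣ) : UnitsModSign K), ?_⟩
  have h1 : unitOneSub σ w⁻¹ = u := by
    rw [map_inv, inv_eq_iff_mul_eq_one]
    apply Units.ext
    have h2 := unitOneSub_coe_mul (σ := σ) w
    rw [hσx] at h2
    rw [Units.val_mul, Units.val_one]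
    refine w.isUnit.mul_right_cancel ?_
    rw [one_mul, mul_assoc, h2]
  exact congrArg (fun v : (𝓞 K)ˣ => (v : UnitsModSign K)) h1

theorem ramifiedProductClass_eq_one_iff (hp2 : p ≠ 2)
    (hσ : ∀ g : Gal(K/ℚ), g ∈ Subgroup.zpowers σ)
    {u : (𝓞 K)ˣ} (hu : (u : UnitsModSign K) ∉ (unitsModSignOneSub σ).range)
    (hun : Algebra.norm ℚ ((u : 𝓞 K) : K) = 1) {x : 𝓞 K} {a : ramifiedPrimeIdeals K →₀ ℕ}
    (hx : x ≠ 0) (hσx : σ • x = (u : 𝓞 K) * x) (hxa : Ideal.span {x} = ramifiedProduct a)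
    (e : ramifiedPrimeIdeals K →₀ ℤ) :
    ramifiedProductClass e = 1 ↔ ∃ k : ℤ, ∀ P, e P ≡ k * (a P : ℤ) [ZMOD (p : ℤ)] := by
  constructor
  · intro he
    obtain ⟨b, hb, hbe⟩ := exists_mk0_ramifiedProduct_eq hp hdeg e
    rw [he, ClassGroup.mk0_eq_one_iff] at hbe
    obtain ⟨y, hy⟩ := hbe
    have hy : ramifiedProduct b = Ideal.span {y} := hy
    have hb0 := ramifiedProduct_ne_zero b
    have hy0 : y ≠ 0 := by rintro rfl; simp [hy] at hb0
    have hσb : σ • ramifiedProduct b = ramifiedProduct b := by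
      rw [ramifiedProduct, Finsupp.prod, Finset.smul_prod']
      exact Finset.prod_congr rfl fun P _ => by
        rw [smul_pow', smul_asIdeal_of_ramified hp hdeg P]
    rw [hy, smul_span_singleton, Ideal.span_singleton_eq_span_singleton] at hσb
    obtain ⟨v, hv⟩ := hσb.symm
    have hvn : Algebra.norm ℚ ((v : 𝓞 K) : K) = 1 := by
      have h1 : (y : K) * ((v : 𝓞 K) : K) = ((σ • y : 𝓞 K) : K) := by
        rw [← hv]; exact (map_mul (algebraMap (𝓞 K) K) _ _).symm
      have h2 := congrArg (Algebra.norm ℚ) h1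
      rw [map_mul, norm_smul] at h2
      have hy' : (y : K) ≠ 0 := by simpa using hy0
      exact mul_left_cancel₀ (Algebra.norm_ne_zero_iff.2 hy') (h2.trans (mul_one _).symm)
    obtain ⟨k, w, hk⟩ := exists_eq_zpow_mul hdeg hσ hp hp2 hu hun hvn
    -- Splitting `k` as `k.toNat - (-k).toNat` keeps all exponents natural, so the identities hold
    -- in `𝓞 K`.
    have hw : (v : 𝓞 K) * (u : 𝓞 K) ^ (-k).toNat * σ • (w : 𝓞 K) =
        (u : 𝓞 K) ^ k.toNat * (w : 𝓞 K) := by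
      have h1 : v * u ^ (-k).toNat = u ^ k.toNat * unitOneSub σ w := by
        rw [hk, mul_right_comm, ← zpow_natCast, ← zpow_natCast, ← zpow_add]
        congr 2; omega
      have h2 := congrArg Units.val h1
      push_cast at h2
      rw [h2, mul_assoc, unitOneSub_coe_mul]
    -- The quotient `y w / x^k` is fixed by `σ`, hence rational; comparing exponents modulo `p` then
    -- gives the relation.
    obtain ⟨m, n, hm, hn, hmn⟩ := exists_intCast_mul_eq_of_smul_mul_eq hσ
      (x := y * w * x ^ (-k).toNat) (y := x ^ k.toNat)
      (mul_ne_zero (mul_ne_zero hy0 w.ne_zero) (pow_ne_zero _ hx)) (pow_ne_zero _ hx) (by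
        rw [smul_mul', smul_mul', smul_pow', smul_pow', hσx, ← hv, mul_pow, mul_pow]
        linear_combination y * x ^ (-k).toNat * x ^ k.toNat * hw)
    have hspan : Ideal.span {(m : 𝓞 K)} * ramifiedProduct (b + (-k).toNat • a) =
        Ideal.span {(n : 𝓞 K)} * ramifiedProduct (k.toNat • a) := by
      have hnsmul : ∀ j : ℕ, ramifiedProduct (j • a) = Ideal.span {x ^ j} := by
        intro j
        induction j with
        | zero =>
          rw [zero_smul, ramifiedProduct_zero, pow_zero, Ideal.span_singleton_one, Ideal.one_eq_top]
        | succ j ih => rw [succ_nsmul, ramifiedProduct_add, ih, ← hxa,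
            Ideal.span_singleton_mul_span_singleton, pow_succ]
      rw [ramifiedProduct_add, hnsmul, hnsmul, hy, Ideal.span_singleton_mul_span_singleton,
        Ideal.span_singleton_mul_span_singleton, Ideal.span_singleton_mul_span_singleton, ← hmn,
        Ideal.span_singleton_eq_span_singleton]
      exact ⟨w, by ring⟩
    refine ⟨k, fun P => (hb P).symm.trans ?_⟩
    have h1 := modEq_of_span_mul_ramifiedProduct_eq hp hdeg hm hn hspan P
    rw [← Int.natCast_modEq_iff] at h1
    simp only [Finsupp.add_apply, Finsupp.smul_apply, smul_eq_mul] at h1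
    push_cast at h1
    have h2 := h1.sub_right (((-k).toNat : ℤ) * a P)
    rw [add_sub_cancel_right, ← sub_mul] at h2
    have h3 : ((k.toNat : ℤ) - ((-k).toNat : ℤ)) = k := by omega
    rwa [h3] at h2
  · rintro ⟨k, hk⟩
    have ha1 : ramifiedProductClass (a.mapRange (fun n : ℕ => (n : ℤ)) Nat.cast_zero) = 1 := by
      rw [← mk0_ramifiedProduct a (mem_nonZeroDivisors_iff_ne_zero.2 (ramifiedProduct_ne_zero a)),
        ClassGroup.mk0_eq_one_iff, ← hxa]
      exact ⟨⟨_, rfl⟩⟩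
    rw [ramifiedProductClass_congr hp hdeg (f := k • a.mapRange (fun n : ℕ => (n : ℤ))
      Nat.cast_zero) (fun P => by simpa using hk P), ramifiedProductClass_zsmul, ha1, one_zpow]

/-- The kernel of the map from exponent vectors to classes is the preimage of the line `T` spanned
by `a` modulo `p`, so the order is the index of `T` in `(ℤ/p)^r`. -/
theorem card_invariantClasses (hp2 : p ≠ 2)
    (hσ : ∀ g : Gal(K/ℚ), g ∈ Subgroup.zpowers σ) {a : ramifiedPrimeIdeals K →₀ ℕ} (ha : a ≠ 0)
    (hap : ∀ P, a P < p) (hker : ∀ e : ramifiedPrimeIdeals K →₀ ℤ, ramifiedProductClass e = 1 ↔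
      ∃ k : ℤ, ∀ P, e P ≡ k * (a P : ℤ) [ZMOD (p : ℤ)]) :
    Nat.card (invariantClasses K) = p ^ ((ramifiedRationalPrimes K).ncard - 1) := by
  have := Fact.mk hp
  obtain ⟨P₀, hP₀⟩ := Finsupp.ne_iff.1 ha
  have hfin : Finite (ramifiedPrimeIdeals K) := finite_ramifiedPrimeIdeals hp hdeg
  let T : AddSubgroup (ramifiedPrimeIdeals K → ZMod p) :=
    AddSubgroup.zmultiples fun P => (a P : ZMod p)
  have hT : Nat.card T = p := by
    rw [Nat.card_zmultiples]
    apply addOrderOf_eq_prime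
    · ext P; simp
    · intro h
      have h1 := congrFun h P₀
      rw [Pi.zero_apply, ZMod.natCast_eq_zero_iff] at h1
      exact hP₀ (Nat.eq_zero_of_dvd_of_lt h1 (hap P₀))
  let ρ : (ramifiedPrimeIdeals K →₀ ℤ) →+ (ramifiedPrimeIdeals K → ZMod p) :=
    AddMonoidHom.mk' (fun e P => (e P : ZMod p)) fun e f => by ext P; simp
  have hρ : Function.Surjective ρ := by
    intro f
    refine ⟨Finsupp.equivFunOnFinite.symm fun P => ((f P).val : ℤ), ?_⟩
    ext P; simp [ρ]
  have hkerT : (ramifiedProductClassHom K).ker = T.comap ρ := by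
    ext e
    rw [AddMonoidHom.mem_ker, AddSubgroup.mem_comap, AddSubgroup.mem_zmultiples_iff]
    refine (hker e).trans (exists_congr fun k => ?_)
    rw [funext_iff]
    refine forall_congr' fun P => ?_
    rw [← ZMod.intCast_eq_intCast_iff, eq_comm]
    simp [ρ]
  have hcard : Nat.card (invariantClasses K) = T.index := by
    rw [← AddSubgroup.index_comap_of_surjective T hρ, ← hkerT, AddSubgroup.index_ker]
    exact Nat.card_congr (Equiv.subtypeEquiv Additive.ofMul fun c =>
      mem_invariantClasses_iff_exists_ramifiedProductClass hp hdeg hp2 hσ)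
  have h1 := T.card_mul_index
  rw [hT, Nat.card_fun, Nat.card_zmod, ← ncard_ramifiedRationalPrimes hp hdeg, ← hcard] at h1
  have hr : (ramifiedRationalPrimes K).ncard ≠ 0 := by
    rw [ncard_ramifiedRationalPrimes hp hdeg]
    have : Nonempty (ramifiedPrimeIdeals K) := ⟨P₀⟩
    exact Nat.card_pos.ne'
  obtain ⟨r, hr⟩ := Nat.exists_eq_succ_of_ne_zero hr
  rw [hr, pow_succ'] at h1
  rw [hr]
  exact Nat.eq_of_mul_eq_mul_left hp.pos h1

end Galois
end CyclicClassGroup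
end

theorem mainTheorem7 {K : Type*} [Field K] [NumberField K] [IsGalois ℚ K]
    (p : ℕ) (hp : p.Prime) (hp2 : p ≠ 2) (hdeg : Module.finrank ℚ K = p)
    (σ : Gal(K/ℚ)) (hσ : ∀ g : Gal(K/ℚ), g ∈ Subgroup.zpowers σ) :
    -- the order of the invariant part of the class group
    0 < (CyclicClassGroup.ramifiedRationalPrimes K).ncard ∧
    Nat.card (CyclicClassGroup.invariantClasses K) =
      p ^ ((CyclicClassGroup.ramifiedRationalPrimes K).ncard - 1) ∧
    -- the invariant part is contained in the `p`-torsion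
    (∀ c ∈ CyclicClassGroup.invariantClasses K, c ^ p = 1) ∧
    -- it is generated by the classes of the ramified primes
    CyclicClassGroup.invariantClasses K =
      Subgroup.closure (CyclicClassGroup.primeClass '' CyclicClassGroup.ramifiedPrimeIdeals K) ∧
    -- the image of `1 - σ` on the units modulo sign has index `p`
    (CyclicClassGroup.unitsModSignOneSub σ).range.index = p ∧
    -- every class outside this image yields the relation between the ramified primes
    ∀ c : CyclicClassGroup.UnitsModSign K,
      c ∉ (CyclicClassGroup.unitsModSignOneSub σ).range →
      ∃ (u : (𝓞 K)ˣ) (x : 𝓞 K) (a : CyclicClassGroup.ramifiedPrimeIdeals K →₀ ℕ),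
        (u : CyclicClassGroup.UnitsModSign K) = c ∧
        x ≠ 0 ∧
        σ • x = (u : 𝓞 K) * x ∧
        (∀ P, a P < p) ∧
        a ≠ 0 ∧
        Ideal.span {x} = a.prod (fun P n => P.1.asIdeal ^ n) ∧
        ∀ e : CyclicClassGroup.ramifiedPrimeIdeals K →₀ ℤ,
          CyclicClassGroup.ramifiedProductClass e = 1 ↔
            ∃ k : ℤ, ∀ P, e P ≡ k * (a P : ℤ) [ZMOD (p : ℤ)] := by
  open CyclicClassGroup in
  have hrel : ∀ c : UnitsModSign K, c ∉ (unitsModSignOneSub σ).range →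
      ∃ (u : (𝓞 K)ˣ) (x : 𝓞 K) (a : ramifiedPrimeIdeals K →₀ ℕ),
        (u : UnitsModSign K) = c ∧ x ≠ 0 ∧ σ • x = (u : 𝓞 K) * x ∧ (∀ P, a P < p) ∧ a ≠ 0 ∧
        Ideal.span {x} = a.prod (fun P n => P.1.asIdeal ^ n) ∧
        ∀ e : ramifiedPrimeIdeals K →₀ ℤ, ramifiedProductClass e = 1 ↔
          ∃ k : ℤ, ∀ P, e P ≡ k * (a P : ℤ) [ZMOD (p : ℤ)] := by
    intro c hc
    obtain ⟨u, rfl, hun⟩ := exists_norm_one_rep hdeg hp hp2 c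
    obtain ⟨x, a, hx, hσx, hap, ha, hxa⟩ := exists_relation hp hdeg hσ hc hun
    exact ⟨u, x, a, rfl, hx, hσx, hap, ha, hxa,
      ramifiedProductClass_eq_one_iff hp hdeg hp2 hσ hc hun hx hσx hxa⟩
  have hidx := CyclicClassGroup.index_range_unitsModSignOneSub hdeg hσ hp hp2
  -- Index `p > 1` supplies a class outside the image; its nonzero relation also shows that some
  -- prime ramifies.
  obtain ⟨c, hc⟩ : ∃ c, c ∉ (CyclicClassGroup.unitsModSignOneSub σ).range := by
    by_contra! h
    rw [(Subgroup.eq_top_iff' _).2 h, Subgroup.index_top] at hidx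
    exact hp.one_lt.ne hidx
  obtain ⟨u, x, a, -, -, -, hap, ha, -, hker⟩ := hrel c hc
  refine ⟨?_, CyclicClassGroup.card_invariantClasses hp hdeg hp2 hσ ha hap hker, ?_,
    CyclicClassGroup.invariantClasses_eq_closure hp hdeg hp2 hσ, hidx, hrel⟩
  · rw [CyclicClassGroup.ncard_ramifiedRationalPrimes hp hdeg]
    have := CyclicClassGroup.finite_ramifiedPrimeIdeals (K := K) hp hdeg
    obtain ⟨P, -⟩ := Finsupp.ne_iff.1 ha
    have : Nonempty (CyclicClassGroup.ramifiedPrimeIdeals K) := ⟨P⟩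
    exact Nat.card_pos
  · intro c hc
    obtain ⟨e, rfl⟩ :=
      (CyclicClassGroup.mem_invariantClasses_iff_exists_ramifiedProductClass hp hdeg hp2 hσ).1 hc
    exact CyclicClassGroup.ramifiedProductClass_pow hp hdeg e
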